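/- Let $n\ge 2$ and $S\subseteq[n]=\{1,\dots,n\}$, with vertex labels read modulo $n$. Let $C_n^S$ be the digraph on $[n]$, without multiple edges, whose edge set is the union of $\{(i,i+1): i\in[n]\}$ (the clockwise edges) and $\{(i,i-1): i\in S\}$ (the counterclockwise edges); for $n=2$ coinciding edges are counted once. Let $D$ be a digraph on $[n]$ isomorphic to $C_n^S$ (i.e. equal to $C_n^S$ up to a relabeling of the vertices). The Laplacian matrix of $D$ is $L(D)=O(D)-A(D)$, where $O(D)$ is the diagonal matrix of outdegrees and $A(D)$ is the adjacency matrix, and $P_D\subset\mathbb R^n$ is the convex hull of the rows of $L(D)$. A converging tree with root $r$ is a weakly connected digraph in which $r$ has outdegree $0$ and every other vertex has outdegree $1$; let $c(D)$ be the number of pairs $(r,T)$ where $r\in[n]$ and $T$ is a subgraph of $D$ with vertex set $[n]$ that is a converging tree with root $r$. A full-dimensional lattice polytope $Q\subset\mathbb R^d$ with $\mathbf 0$ in its interior is called reflexive if $Q^*=\{x\in\mathbb R^d : x\cdot y\le 1 \text{ for all } y\in Q\}$ is a lattice polytope. A lattice polytope $P\subset\mathbb R^n$, not necessarily full-dimensional,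 is called reflexive if it is unimodularly equivalent to such a $Q$, i.e. if there are such a $Q$ and an affine isomorphism from the affine span of $P$ onto $\mathbb R^d$ that maps the integer points of the affine span of $P$ onto $\mathbb Z^d$ and maps $P$ onto $Q$. Then $P_D$ is reflexive if and only if one of the following conditions holds: 1. $S=\varnothing$; 2. $S=[n]$ and $n=2$; 3. $S=[n]$ and $n$ is odd; 4. $\varnothing\subsetneq S\subsetneq[n]$ and $k\mid c(D)$ for every integer $1\le k\le K+1$, where $K=\max\{\,j\le n : \{a+1,\dots,a+j\}\subseteq S \text{ for some } a\in[n]\,\}$ (indices modulo $n$) is the largest number of consecutive edges pointing counterclockwise. -/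

import Mathlib

noncomputable section

namespace LaplacianPolytope

/-! ### Lattice polytopes, duality and reflexivity -/

/-- The integer lattice `ℤ^ι` inside `ℝ^ι`. -/
def intLattice (ι : Type*) : Set (ι → ℝ) :=
  {x | ∀ i, ∃ m : ℤ, x i = (m : ℝ)}

/-- A lattice polytope is the convex hull of finitely many lattice points. -/
def IsLatticePolytope {ι : Type*} (P : Set (ι → ℝ)) : Prop :=
  ∃ s : Set (ι → ℝ), s.Finite ∧ s ⊆ intLattice ι ∧ P = convexHull ℝ s

/-- The dual `{x | x · y ≤ 1 for all y ∈ P}`. -/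
def dualPolytope {ι : Type*} [Fintype ι] (P : Set (ι → ℝ)) : Set (ι → ℝ) :=
  {x | ∀ y ∈ P, x ⬝ᵥ y ≤ 1}

/-- Two polytopes, possibly in spaces of different dimensions, are unimodularly equivalent if
there is an affine isomorphism between their affine spans that identifies the lattice points of
one affine span with the lattice points of the other and maps `P` onto `Q`.
(The affine span of `Q` is then automatically the image of the affine span of `P`.) -/
def UnimodularlyEquivalent {ι κ : Type*} (P : Set (ι → ℝ)) (Q : Set (κ → ℝ)) : Prop :=
  ∃ f : (ι → ℝ) →ᵃ[ℝ] (κ → ℝ),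
    Set.InjOn f (affineSpan ℝ P : Set (ι → ℝ)) ∧
    f '' ((affineSpan ℝ P : Set (ι → ℝ)) ∩ intLattice ι)
      = (affineSpan ℝ Q : Set (κ → ℝ)) ∩ intLattice κ ∧
    f '' P = Q

/-- A full-dimensional lattice polytope in `ℝ^d` that contains the origin in its interior, and
whose dual is again a lattice polytope. -/
def IsReflexiveFullDim {d : ℕ} (Q : Set (Fin d → ℝ)) : Prop :=
  IsLatticePolytope Q ∧ 0 ∈ interior Q ∧ IsLatticePolytope (dualPolytope Q)

/-- A polytope, not necessarily full-dimensional in its ambient space, is reflexive if it is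
unimodularly equivalent to a full-dimensional lattice polytope `Q` with the origin in its
interior whose dual is a lattice polytope. -/
def IsReflexive {ι : Type*} (P : Set (ι → ℝ)) : Prop :=
  ∃ (d : ℕ) (Q : Set (Fin d → ℝ)), IsReflexiveFullDim Q ∧ UnimodularlyEquivalent P Q

/-! ### Digraphs, Laplacians and spanning converging trees -/

variable {V : Type*}

/-- The number of directed edges with tail `i`. -/
def outdeg (D : Digraph V) (i : V) : ℕ := Nat.card {j : V // D.Adj i j}

open Classical in
/-- The adjacency matrix of a simple digraph: entry `(i, j)` is the number (`0` or `1`) of edges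
from `i` to `j`. -/
def adjMatrix (D : Digraph V) : Matrix V V ℤ :=
  Matrix.of fun i j => if D.Adj i j then 1 else 0

open Classical in
/-- The Laplacian matrix: outdegree matrix minus adjacency matrix. -/
def laplacian (D : Digraph V) : Matrix V V ℤ :=
  Matrix.diagonal (fun i => (outdeg D i : ℤ)) - adjMatrix D

/-- The Laplacian polytope: the convex hull in `ℝ^V` of the rows of the Laplacian matrix. -/
def laplacianPolytope (D : Digraph V) : Set (V → ℝ) :=
  convexHull ℝ (Set.range fun i : V => fun j : V => ((laplacian D i j : ℤ) : ℝ))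

/-- A converging tree with root `r` on the vertex set `V`: a weakly connected digraph in which
`r` has outdegree zero and every other vertex has outdegree one. -/
def IsConvergingTree (T : Digraph V) (r : V) : Prop :=
  T.toSimpleGraphInclusive.Connected ∧ outdeg T r = 0 ∧ ∀ v, v ≠ r → outdeg T v = 1

/-- The number `c_r` of spanning subgraphs of `D` that are converging trees with root `r`. -/
def treeCount (D : Digraph V) (r : V) : ℕ :=
  Nat.card {T : Digraph V // T ≤ D ∧ IsConvergingTree T r}

/-- The complexity `c(D)`: the total number of spanning converging trees of `D`. -/
def complexity [Fintype V] (D : Digraph V) : ℕ := ∑ r : V, treeCount D r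

/-! ### Cycle digraphs -/

/-- The simple digraph `C_n^S` on `ℤ/n` (vertices written as `Fin n`, with addition modulo `n`):
it has all clockwise edges `(i, i + 1)`, and the counterclockwise edges `(i, i - 1)` with tail
`i` in `S`. -/
def cycleDigraph (n : ℕ) [NeZero n] (S : Set (Fin n)) : Digraph (Fin n) where
  Adj i j := j = i + 1 ∨ (i ∈ S ∧ j = i - 1)

/-- The largest `j ≤ n` such that `{a + 1, …, a + j} ⊆ S` for some `a`, indices modulo `n`: the
length of the longest run of consecutive counterclockwise edges of `C_n^S`. -/
def longestRun (n : ℕ) [NeZero n] (S : Set (Fin n)) : ℕ :=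
  sSup {j : ℕ | j ≤ n ∧ ∃ a : Fin n, ∀ i : ℕ, 1 ≤ i → i ≤ j → a + Fin.ofNat n i ∈ S}

end LaplacianPolytope

end

/-! The rows of the Laplacian span the hyperplane of coordinate sum zero and satisfy one linear
relation, with positive coefficients `c`. So the polytope is a simplex with the origin in its
relative interior, and the vertices of its dual are the functionals equal to 1 on all rows but the
`r`-th. An equivalence with a reflexive polytope must fix the origin. Hence reflexivity means that
for every `r` some integer vector `v` satisfies `(Lv)_j = 1` for all `j ≠ r`
(`isReflexive_convexHull_rows_iff`).

For the cycle put `d i = v (i+1) - v i`. Then `(Lv)_i = [i ∈ S] d (i-1) - d i`, and `d` comes from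
some `v` exactly when its cyclic sum is zero. If `S` is not everything, `nextGap` is the positive
left kernel vector, and the system for `r` is solvable over the integers iff `nextGap S r` divides
the sum of all gaps (`exists_int_cycleDigraph_iff`). A converging tree rooted at `r` is determined
by how many vertices after `r` point counterclockwise, so `nextGap S r` also counts these trees
(`treeCount_cycleDigraph`) and the sum of the gaps is the complexity. The gaps take exactly the
values `1, ..., K+1`, which gives the divisibility condition.

If `S` is everything and `n ≥ 3`, the differences `d` form an arithmetic progression with step `-1`,
whose sum can vanish only for odd `n`. For `n = 2` the digraph does not depend on `S`. -/

noncomputable section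

namespace LaplacianPolytope

/-! ### Simplices spanned by matrix rows, and their duals -/

section Rows

variable {ι : Type*} [Fintype ι]

theorem exists_dotProduct_eq (φ : (ι → ℝ) →ₗ[ℝ] ℝ) : ∃ v : ι → ℝ, ∀ x, φ x = x ⬝ᵥ v := by
  classical
  refine ⟨fun i => φ (Pi.single i 1), fun x => ?_⟩
  rw [LinearMap.pi_apply_eq_sum_univ φ x]
  refine Finset.sum_congr rfl fun i _ => ?_
  have : (fun j => if i = j then (1 : ℝ) else 0) = Pi.single i 1 := by
    ext j; simp [Pi.single_apply, eq_comm]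
  rw [this, smul_eq_mul]

theorem zero_mem_convexHull_range [Nonempty ι] {E : Type*} [AddCommGroup E] [Module ℝ E]
    {R : ι → E} {c : ι → ℝ} (hc : ∀ i, 0 < c i) (hcR : ∑ i, c i • R i = 0) :
    (0 : E) ∈ convexHull ℝ (Set.range R) := by
  have hpos : 0 < ∑ i, c i := Finset.sum_pos (fun i _ => hc i) Finset.univ_nonempty
  have h : ∑ i, ((∑ j, c j)⁻¹ * c i) • R i ∈ convexHull ℝ (Set.range R) := by
    refine (convex_convexHull ℝ _).sum_mem (fun i _ => ?_) ?_ fun i _ =>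
      subset_convexHull ℝ _ ⟨i, rfl⟩
    · exact mul_nonneg (inv_nonneg.2 hpos.le) (hc i).le
    · rw [← Finset.mul_sum, inv_mul_cancel₀ hpos.ne']
  simpa only [mul_smul, ← Finset.smul_sum, hcR, smul_zero] using h

variable {R : ι → ι → ℝ} {c : ι → ℝ}

/-- A functional that kills all rows is the dot product with a right kernel vector, hence with a
constant vector, so it also kills every vector of sum zero. -/
theorem mem_span_rows (hker : ∀ v : ι → ℝ, (∀ i, R i ⬝ᵥ v = 0) → ∀ i j, v i = v j)
    {x : ι → ℝ} (hx : ∑ i, x i = 0) : x ∈ Submodule.span ℝ (Set.range R) := by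
  by_contra h
  obtain ⟨φ, hφx, hφ⟩ := Submodule.exists_le_ker_of_notMem h
  obtain ⟨v, hv⟩ := exists_dotProduct_eq φ
  have hconst := hker v fun i => by
    rw [← hv]; exact hφ (Submodule.subset_span ⟨i, rfl⟩)
  apply hφx
  rw [hv]
  rcases isEmpty_or_nonempty ι with hι | ⟨⟨i⟩⟩
  · simp [dotProduct]
  · have : v = fun _ => v i := funext fun j => hconst j i
    rw [this, dotProduct, ← Finset.sum_mul, hx, zero_mul]

theorem mem_affineSpan_rows_iff [Nonempty ι] (hc : ∀ i, 0 < c i) (hcR : ∑ i, c i • R i = 0)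
    (hrow : ∀ i, ∑ j, R i j = 0)
    (hker : ∀ v : ι → ℝ, (∀ i, R i ⬝ᵥ v = 0) → ∀ i j, v i = v j) (x : ι → ℝ) :
    x ∈ affineSpan ℝ (convexHull ℝ (Set.range R)) ↔ ∑ i, x i = 0 := by
  have h0 : (0 : ι → ℝ) ∈ affineSpan ℝ (Set.range R) := by
    rw [← affineSpan_convexHull]
    exact subset_affineSpan ℝ _ (zero_mem_convexHull_range hc hcR)
  have hspan : affineSpan ℝ (Set.range R) = affineSpan ℝ (insert 0 (Set.range R)) :=
    le_antisymm (affineSpan_mono ℝ (Set.subset_insert _ _))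
      (affineSpan_le.2 (Set.insert_subset h0 (subset_affineSpan ℝ _)))
  rw [affineSpan_convexHull, hspan, ← SetLike.mem_coe, affineSpan_insert_zero, SetLike.mem_coe]
  refine ⟨fun h => ?_, mem_span_rows hker⟩
  induction h using Submodule.span_induction with
  | mem x hx => obtain ⟨i, rfl⟩ := hx; exact hrow i
  | zero => simp
  | add x y _ _ hx hy => simp [Finset.sum_add_distrib, hx, hy]
  | smul a x _ hx => simp [← Finset.mul_sum, hx]

/-- The functional that is `1` on all rows but the `r`-th one. -/
theorem exists_dual_vertex (hc : ∀ i, 0 < c i) (hcR : ∑ i, c i • R i = 0)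
    (hrow : ∀ i, ∑ j, R i j = 0)
    (hker : ∀ v : ι → ℝ, (∀ i, R i ⬝ᵥ v = 0) → ∀ i j, v i = v j) (r : ι) :
    ∃ w : ι → ℝ, (∀ j, j ≠ r → R j ⬝ᵥ w = 1) ∧ R r ⬝ᵥ w ≤ 1 := by
  classical
  let M : (ι → ℝ) →ₗ[ℝ] (ι → ℝ) := Matrix.mulVecLin (Matrix.of R)
  let C : (ι → ℝ) →ₗ[ℝ] ℝ := Fintype.linearCombination ℝ c
  have hCapp : ∀ x, C x = ∑ i, x i * c i := fun x => by
    simp [C, Fintype.linearCombination_apply]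
  have hMapp : ∀ v i, M v i = R i ⬝ᵥ v := fun v i => rfl
  have hle : LinearMap.range M ≤ LinearMap.ker C := by
    rintro _ ⟨v, rfl⟩
    rw [LinearMap.mem_ker, hCapp]
    have := congrArg (fun y => y ⬝ᵥ v) hcR
    simp only [sum_dotProduct, smul_dotProduct, zero_dotProduct, smul_eq_mul] at this
    simpa only [hMapp, mul_comm] using this
  have hkerM : Module.finrank ℝ (LinearMap.ker M) ≤ 1 := by
    refine finrank_le_one (⟨fun _ => 1, ?_⟩) ?_
    · ext i; simp [hMapp, dotProduct, hrow]
    · rintro ⟨w, hw⟩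
      refine ⟨w r, ?_⟩
      ext j
      simpa using hker w (fun i => congrFun hw i) r j
  have hrank := LinearMap.finrank_range_add_finrank_ker M
  have hCsurj : Function.Surjective C := by
    intro t
    refine ⟨Pi.single r (t / c r), ?_⟩
    rw [hCapp, Finset.sum_eq_single r]
    · simp [(hc r).ne']
    · intro b _ hb; simp [hb]
    · simp
  have hrankC := LinearMap.finrank_range_add_finrank_ker C
  rw [LinearMap.range_eq_top.2 hCsurj, finrank_top, Module.finrank_self] at hrankC
  -- The kernel of `M` has dimension at most one, so its range is as large as the hyperplane `ker C`
  -- that contains it.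
  have heq : LinearMap.range M = LinearMap.ker C :=
    Submodule.eq_of_le_of_finrank_le hle (by omega)
  -- The entry at `r` is forced: the `c`-weighted sum of the values must vanish.
  have hmem : (fun j => 1 - (if j = r then (∑ i, c i) / c r else 0) : ι → ℝ)
      ∈ LinearMap.range M := by
    rw [heq, LinearMap.mem_ker, hCapp]
    simp [sub_mul, Finset.sum_sub_distrib, ite_mul, (hc r).ne']
  obtain ⟨w, hw⟩ := hmem
  refine ⟨w, fun j hj => ?_, ?_⟩
  · rw [← hMapp, hw]; simp [hj]
  · rw [← hMapp, hw]
    have : 0 ≤ (∑ i, c i) / c r := div_nonneg (Finset.sum_nonneg fun i _ => (hc i).le) (hc r).le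
    simpa using this

end Rows

theorem mem_dualPolytope_convexHull {ι : Type*} [Fintype ι] {s : Set (ι → ℝ)} {x : ι → ℝ} :
    x ∈ dualPolytope (convexHull ℝ s) ↔ ∀ y ∈ s, x ⬝ᵥ y ≤ 1 := by
  refine ⟨fun h y hy => h y (subset_convexHull ℝ s hy), fun h y hy => ?_⟩
  have hconv : Convex ℝ {y : ι → ℝ | x ⬝ᵥ y ≤ 1} :=
    convex_halfSpace_le ⟨dotProduct_add x, fun a y => dotProduct_smul a x y⟩ 1
  exact convexHull_min h hconv hy

theorem exists_int_dotProduct {ι : Type*} [Fintype ι] {x y : ι → ℝ} (hx : x ∈ intLattice ι)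
    (hy : y ∈ intLattice ι) : ∃ m : ℤ, x ⬝ᵥ y = m := by
  choose a ha using hx
  choose b hb using hy
  exact ⟨∑ i, a i * b i, by simp [dotProduct, ha, hb]⟩

section

variable {ι : Type*} [Fintype ι] {R : ι → ι → ℝ} {c : ι → ℝ}

/-- An equivalence of the simplex with a reflexive polytope fixes the origin, the unique interior
lattice point. -/
theorem map_zero_of_isReflexiveFullDim [Nonempty ι] {d : ℕ} {g : ι → Fin d → ℝ}
    (hc : ∀ i, 0 < c i) {z : Fin d → ℝ} (hzint : z ∈ intLattice (Fin d))
    (hz : ∑ i, c i • g i = (∑ i, c i) • z)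
    (hQ : IsReflexiveFullDim (convexHull ℝ (Set.range g))) : z = 0 := by
  obtain ⟨-, h0, s, -, hsint, hdual⟩ := hQ
  have hs : ∀ u ∈ s, ∀ i, u ⬝ᵥ g i ≤ 1 := fun u hu i => by
    have : u ∈ dualPolytope (convexHull ℝ (Set.range g)) := hdual ▸ subset_convexHull ℝ s hu
    exact mem_dualPolytope_convexHull.1 this _ ⟨i, rfl⟩
  -- If the integer `u ⬝ᵥ z` were positive it would be at least 1. As `z` is a weighted mean of the
  -- `g i`, all `u ⬝ᵥ g i` would then equal 1, and so would `u ⬝ᵥ 0`.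
  have hnonpos : ∀ u ∈ s, u ⬝ᵥ z ≤ 0 := by
    intro u hu
    obtain ⟨m, hm⟩ := exists_int_dotProduct (hsint hu) hzint
    by_contra! hpos
    have hm1 : (1 : ℝ) ≤ u ⬝ᵥ z := by
      rw [hm] at hpos ⊢
      exact_mod_cast (Int.add_one_le_iff.2 (by exact_mod_cast hpos) : 0 + 1 ≤ m)
    have hsum : ∑ i, c i * (1 - u ⬝ᵥ g i) = (∑ i, c i) * (1 - u ⬝ᵥ z) := by
      have := congrArg (fun y => u ⬝ᵥ y) hz
      simp only [dotProduct_sum, dotProduct_smul, smul_eq_mul] at this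
      simp only [mul_sub, mul_one, Finset.sum_sub_distrib, this]
    have hnn : ∀ i ∈ Finset.univ, 0 ≤ c i * (1 - u ⬝ᵥ g i) := fun i _ =>
      mul_nonneg (hc i).le (sub_nonneg.2 (hs u hu i))
    have hzero : ∑ i, c i * (1 - u ⬝ᵥ g i) = 0 := by
      refine le_antisymm ?_ (Finset.sum_nonneg hnn)
      rw [hsum]
      exact mul_nonpos_of_nonneg_of_nonpos (Finset.sum_nonneg fun i _ => (hc i).le) (by linarith)
    have hone : ∀ i, u ⬝ᵥ g i = 1 := fun i => by
      have := (Finset.sum_eq_zero_iff_of_nonneg hnn).1 hzero i (Finset.mem_univ i)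
      rcases mul_eq_zero.1 this with h | h
      · exact absurd h (hc i).ne'
      · linarith
    have hconv : Convex ℝ {y : Fin d → ℝ | u ⬝ᵥ y = 1} :=
      convex_hyperplane ⟨dotProduct_add u, fun a y => dotProduct_smul a u y⟩ 1
    have := convexHull_min (by rintro _ ⟨i, rfl⟩; exact hone i) hconv (interior_subset h0)
    simp at this
  have hdual_nonpos : ∀ y ∈ dualPolytope (convexHull ℝ (Set.range g)), y ⬝ᵥ z ≤ 0 := by
    intro y hy
    rw [hdual] at hy
    have hconv : Convex ℝ {y : Fin d → ℝ | y ⬝ᵥ z ≤ 0} :=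
      convex_halfSpace_le ⟨fun a b => add_dotProduct a b z, fun a y => smul_dotProduct a y z⟩ 0
    exact convexHull_min hnonpos hconv hy
  have hBpos : 0 < (∑ i, |z ⬝ᵥ g i| + 1) :=
    add_pos_of_nonneg_of_pos (Finset.sum_nonneg fun i _ => abs_nonneg _) one_pos
  -- A small positive multiple of `z` lies in the dual, where pairing with `z` is nonpositive; this
  -- forces `z ⬝ᵥ z ≤ 0`.
  have hmem : (∑ i, |z ⬝ᵥ g i| + 1)⁻¹ • z ∈ dualPolytope (convexHull ℝ (Set.range g)) := by
    rw [mem_dualPolytope_convexHull]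
    rintro _ ⟨i, rfl⟩
    rw [smul_dotProduct, smul_eq_mul, inv_mul_le_one₀ hBpos]
    have := Finset.single_le_sum (f := fun i => |z ⬝ᵥ g i|) (fun i _ => abs_nonneg _)
      (Finset.mem_univ i)
    have h2 := le_abs_self (z ⬝ᵥ g i)
    linarith
  have hle := hdual_nonpos _ hmem
  rw [smul_dotProduct, smul_eq_mul] at hle
  have hzz : z ⬝ᵥ z ≤ 0 := by
    by_contra! h
    exact absurd hle (not_le.2 (mul_pos (inv_pos.2 hBpos) h))
  have hzz0 : 0 ≤ z ⬝ᵥ z := Finset.sum_nonneg fun i _ => mul_self_nonneg _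
  exact dotProduct_self_eq_zero.1 (le_antisymm hzz hzz0)

/-- The dual vertex opposite row `r`, transported to `Q`, maximizes the sum of the pairings with the
other vertices. Some lattice point generating the dual attains this maximum, hence pairs to 1 with
each of them, and its pullback is the integer vector. -/
theorem exists_int_of_isReflexive [Nonempty ι] {A : Matrix ι ι ℤ}
    (hc : ∀ i, 0 < c i) (hcA : ∑ i, c i • (fun j => (A i j : ℝ)) = 0)
    (hrow : ∀ i, ∑ j, (A i j : ℝ) = 0)
    (hker : ∀ v : ι → ℝ, (∀ i, (fun j => (A i j : ℝ)) ⬝ᵥ v = 0) → ∀ i j, v i = v j)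
    (h : IsReflexive (convexHull ℝ (Set.range fun i j => (A i j : ℝ)))) (r : ι) :
    ∃ v : ι → ℤ, ∀ j, j ≠ r → ∑ k, A j k * v k = 1 := by
  classical
  obtain ⟨d, Q, hQ, f, hinj, himg, hfP⟩ := h
  have hspan := mem_affineSpan_rows_iff hc hcA hrow hker
  have hfint : ∀ x : ι → ℝ, ∑ i, x i = 0 → x ∈ intLattice ι → f x ∈ intLattice (Fin d) :=
    fun x hx hxi => (himg.subset ⟨x, ⟨(hspan x).2 hx, hxi⟩, rfl⟩).2
  set R : ι → ι → ℝ := fun i j => (A i j : ℝ) with hR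
  set g : ι → Fin d → ℝ := fun i => f (R i) with hg
  have hQg : Q = convexHull ℝ (Set.range g) := by
    rw [← hfP, AffineMap.image_convexHull, ← Set.range_comp]; rfl
  rw [hQg] at hQ
  have hdecomp : ∀ x, f x = f.linear x + f 0 := fun x => congrFun (AffineMap.decomp f) x
  have hf0 : f 0 = 0 := by
    refine map_zero_of_isReflexiveFullDim hc (hfint 0 (by simp) fun i => ⟨0, by simp⟩) ?_ hQ
    have hlin : ∑ i, c i • f.linear (R i) = 0 := by
      rw [← map_zero f.linear, ← hcA, map_sum]; simp [hR]
    simp_rw [hg, hdecomp (R _), smul_add, Finset.sum_add_distrib, hlin, ← Finset.sum_smul,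
      zero_add]
  have hflin : ∀ x, f x = f.linear x := fun x => by rw [hdecomp, hf0, add_zero]
  obtain ⟨w, hw1, hwr⟩ := exists_dual_vertex hc hcA hrow hker r
  let H : Submodule ℝ (ι → ℝ) := LinearMap.ker (Fintype.linearCombination ℝ fun _ : ι => (1 : ℝ))
  have hH : ∀ x, x ∈ H ↔ ∑ i, x i = 0 := fun x => by
    simp [H, Fintype.linearCombination_apply]
  obtain ⟨G, hG⟩ := LinearMap.exists_leftInverse_of_injective (f.linear.domRestrict H) (by
    rw [LinearMap.ker_eq_bot]
    rintro ⟨x, hx⟩ ⟨y, hy⟩ hxy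
    rw [Subtype.mk.injEq]
    refine hinj ((hspan x).2 ((hH x).1 hx)) ((hspan y).2 ((hH y).1 hy)) ?_
    rw [hflin, hflin]; exact hxy)
  obtain ⟨y, hy⟩ := exists_dotProduct_eq
    ((dotProductBilin ℝ ℝ w) ∘ₗ H.subtype ∘ₗ G)
  have hyg : ∀ j, y ⬝ᵥ g j = R j ⬝ᵥ w := by
    intro j
    have h1 : G (g j) = ⟨R j, (hH _).2 (hrow j)⟩ := by
      have := LinearMap.congr_fun hG ⟨R j, (hH _).2 (hrow j)⟩
      simpa [hg, hflin] using this
    have h2 := hy (g j)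
    simp only [LinearMap.comp_apply, h1] at h2
    rw [dotProduct_comm, ← h2, dotProduct_comm]; rfl
  obtain ⟨-, -, s, -, hsint, hdual⟩ := hQ
  have hs : ∀ u ∈ s, ∀ i, u ⬝ᵥ g i ≤ 1 := fun u hu i => by
    have : u ∈ dualPolytope (convexHull ℝ (Set.range g)) := hdual ▸ subset_convexHull ℝ s hu
    exact mem_dualPolytope_convexHull.1 this _ ⟨i, rfl⟩
  have hymem : y ∈ convexHull ℝ s := by
    rw [← hdual, mem_dualPolytope_convexHull]
    rintro _ ⟨j, rfl⟩
    rw [hyg]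
    by_cases hj : j = r
    · rw [hj]; exact hwr
    · exact (hw1 j hj).le
  have hconv : ConvexOn ℝ Set.univ
      fun u : Fin d → ℝ => u ⬝ᵥ ∑ j ∈ Finset.univ.erase r, g j :=
    ((dotProductBilin ℝ ℝ).flip (∑ j ∈ Finset.univ.erase r, g j)).convexOn convex_univ
  obtain ⟨u, hu, hyu⟩ := hconv.exists_ge_of_mem_convexHull (Set.subset_univ s) hymem
  have hug : ∀ j, j ≠ r → u ⬝ᵥ g j = 1 := by
    have hle : ∀ j ∈ Finset.univ.erase r, u ⬝ᵥ g j ≤ y ⬝ᵥ g j := fun j hj => by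
      rw [hyg, hw1 j (Finset.ne_of_mem_erase hj)]; exact hs u hu j
    simp only [dotProduct_sum] at hyu
    have heq := (Finset.sum_eq_sum_iff_of_le hle).1 (le_antisymm (Finset.sum_le_sum hle) hyu)
    intro j hj
    rw [heq j (Finset.mem_erase.2 ⟨hj, Finset.mem_univ j⟩), hyg, hw1 j hj]
  -- The vectors `e_i - e_r` generate the lattice of the hyperplane; the pairings with them are the
  -- coordinates of `v`.
  have hvint : ∀ i, ∃ m : ℤ, u ⬝ᵥ f (Pi.single i 1 - Pi.single r 1) = m := fun i =>
    exists_int_dotProduct (hsint hu) (hfint _ (by simp) fun k =>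
      ⟨(Pi.single i 1 - Pi.single r 1 : ι → ℤ) k, by simp [Pi.single_apply]⟩)
  choose v hv using hvint
  refine ⟨v, fun j hj => ?_⟩
  have hexp : R j = ∑ k, R j k • (Pi.single k 1 - Pi.single r 1 : ι → ℝ) := by
    simp only [smul_sub, Finset.sum_sub_distrib, ← Finset.sum_smul]
    rw [show ∑ k, R j k = 0 from hrow j, zero_smul, sub_zero]
    ext i; simp [Pi.single_apply]
  have key : ∑ k, R j k * (v k : ℝ) = 1 := by
    rw [← hug j hj, hg]
    simp only
    rw [hflin, hexp, map_sum, dotProduct_sum]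
    refine Finset.sum_congr rfl fun k _ => ?_
    rw [map_smul, dotProduct_smul, smul_eq_mul, ← hv k, hflin, ← hexp]
  simp only [hR] at key
  exact_mod_cast key

end

/-- Positive weights of total less than 1 form an open set, and a surjective linear map in finite
dimension is open. The image stays in the hull because 0 does. -/
theorem zero_mem_interior_convexHull_range {ι E : Type*} [Fintype ι] [Nonempty ι]
    [NormedAddCommGroup E] [NormedSpace ℝ E] [FiniteDimensional ℝ E] {g : ι → E} {c : ι → ℝ}
    (hc : ∀ i, 0 < c i) (hcg : ∑ i, c i • g i = 0)
    (hspan : Submodule.span ℝ (Set.range g) = ⊤) :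
    (0 : E) ∈ interior (convexHull ℝ (Set.range g)) := by
  let T : (ι → ℝ) →ₗ[ℝ] E := Fintype.linearCombination ℝ g
  have hT : ∀ a, T a = ∑ i, a i • g i := fun a => Fintype.linearCombination_apply ..
  have hsurj : Function.Surjective T := by
    rw [← LinearMap.range_eq_top, Fintype.range_linearCombination, hspan]
  let U : Set (ι → ℝ) := {a | (∀ i, 0 < a i) ∧ ∑ i, a i < 1}
  have hU : IsOpen U := by
    refine IsOpen.and ?_ ?_
    · simp only [Set.ofPred_forall]
      exact isOpen_iInter_of_finite fun i => isOpen_lt continuous_const (continuous_apply i)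
    · exact isOpen_lt (by fun_prop) continuous_const
  have h0 := zero_mem_convexHull_range hc hcg
  have hpos : 0 < ∑ i, c i := Finset.sum_pos (fun i _ => hc i) Finset.univ_nonempty
  rw [mem_interior]
  refine ⟨T '' U, ?_, LinearMap.isOpenMap_of_finiteDimensional T hsurj _ hU, ?_⟩
  · rintro _ ⟨a, ⟨ha, ha1⟩, rfl⟩
    have hs : 0 < ∑ i, a i := Finset.sum_pos (fun i _ => ha i) Finset.univ_nonempty
    have hmem : ∑ i, ((∑ j, a j)⁻¹ * a i) • g i ∈ convexHull ℝ (Set.range g) := by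
      refine (convex_convexHull ℝ _).sum_mem (fun i _ => ?_) ?_ fun i _ =>
        subset_convexHull ℝ _ ⟨i, rfl⟩
      · exact mul_nonneg (inv_nonneg.2 hs.le) (ha i).le
      · rw [← Finset.mul_sum, inv_mul_cancel₀ hs.ne']
    have := (convex_convexHull ℝ _).smul_mem_of_zero_mem h0 hmem ⟨hs.le, ha1.le⟩
    convert this using 1
    rw [hT, Finset.smul_sum]
    refine Finset.sum_congr rfl fun i _ => ?_
    rw [← mul_smul, ← mul_assoc, mul_inv_cancel₀ hs.ne', one_mul]
  -- The factor 2 makes the total weight 1/2, strictly inside the open set.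
  · refine ⟨fun i => (2 * ∑ j, c j)⁻¹ * c i, ⟨fun i => ?_, ?_⟩, ?_⟩
    · exact mul_pos (inv_pos.2 (by positivity)) (hc i)
    · rw [← Finset.mul_sum, mul_inv, mul_assoc, inv_mul_cancel₀ hpos.ne']; norm_num
    · simp only [hT, mul_smul, ← Finset.smul_sum, hcg, smul_zero]

/-- Dropping coordinate 0 identifies the lattice of the hyperplane with `ℤ^m`. The dual of the
projected simplex is the hull of the integer points `y r` obtained from the given solutions. -/
theorem isReflexive_of_exists_int {m : ℕ} {A : Matrix (Fin (m + 1)) (Fin (m + 1)) ℤ}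
    {c : Fin (m + 1) → ℝ}
    (hc : ∀ i, 0 < c i) (hcA : ∑ i, c i • (fun j => (A i j : ℝ)) = 0)
    (hrow : ∀ i, ∑ j, (A i j : ℝ) = 0)
    (hker : ∀ v : Fin (m + 1) → ℝ, (∀ i, (fun j => (A i j : ℝ)) ⬝ᵥ v = 0) → ∀ i j, v i = v j)
    (h : ∀ r, ∃ v : Fin (m + 1) → ℤ, ∀ j, j ≠ r → ∑ k, A j k * v k = 1) :
    IsReflexive (convexHull ℝ (Set.range fun i j => (A i j : ℝ))) := by
  have hspan := mem_affineSpan_rows_iff hc hcA hrow hker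
  have hspan' := fun x => mem_span_rows (x := x) hker
  set R : Fin (m + 1) → Fin (m + 1) → ℝ := fun i j => (A i j : ℝ) with hR
  let f : (Fin (m + 1) → ℝ) →ₗ[ℝ] (Fin m → ℝ) := LinearMap.funLeft ℝ ℝ Fin.succ
  have hf : ∀ x k, f x k = x k.succ := fun x k => rfl
  let g : Fin (m + 1) → Fin m → ℝ := fun i => f (R i)
  have hlift : ∀ y : Fin m → ℝ, ∃ x : Fin (m + 1) → ℝ, ∑ i, x i = 0 ∧ f x = y ∧
      (y ∈ intLattice (Fin m) → x ∈ intLattice (Fin (m + 1))) := by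
    intro y
    refine ⟨Fin.cons (-∑ i, y i) y, by simp [Fin.sum_univ_succ], by ext k; simp [hf], ?_⟩
    intro hy i
    choose b hb using hy
    refine Fin.cases ⟨-∑ i, b i, by simp [hb]⟩ (fun k => ⟨b k, by simp [hb]⟩) i
  have hcg : ∑ i, c i • g i = 0 := by
    rw [← map_zero f, ← hcA, map_sum]; simp [g, hR]
  have hgspan : Submodule.span ℝ (Set.range g) = ⊤ := by
    rw [eq_top_iff]
    rintro y -
    obtain ⟨x, hx, rfl, -⟩ := hlift y
    have := Submodule.mem_map_of_mem (f := f) (hspan' x hx)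
    rwa [Submodule.map_span, ← Set.range_comp] at this
  have hint := zero_mem_interior_convexHull_range hc hcg hgspan
  have hgint : ∀ i, g i ∈ intLattice (Fin m) := fun i k => ⟨A i k.succ, rfl⟩
  have himage : f '' (convexHull ℝ (Set.range R)) = convexHull ℝ (Set.range g) := by
    rw [LinearMap.image_convexHull, ← Set.range_comp]; rfl
  choose v hv using h
  -- Subtracting `v r 0` compensates for the dropped coordinate, which is minus the sum of the
  -- others.
  let y : Fin (m + 1) → Fin m → ℝ := fun r k => ((v r k.succ - v r 0 : ℤ) : ℝ)
  have hdot : ∀ (r : Fin (m + 1)) (x : Fin (m + 1) → ℝ), ∑ i, x i = 0 →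
      y r ⬝ᵥ f x = ∑ k, x k * (v r k : ℝ) := by
    intro r x hx
    rw [Fin.sum_univ_succ] at hx ⊢
    have hx0 : x 0 = -∑ i : Fin m, x i.succ := by linarith
    rw [hx0, neg_mul, Finset.sum_mul, dotProduct, neg_add_eq_sub, ← Finset.sum_sub_distrib]
    refine Finset.sum_congr rfl fun k _ => ?_
    simp only [y, hf]; push_cast; ring
  have hyg : ∀ r j, j ≠ r → y r ⬝ᵥ g j = 1 := by
    intro r j hj
    rw [hdot r (R j) (hrow j)]
    have := hv r j hj
    simp only [hR]
    exact_mod_cast this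
  have hbal : ∀ x : Fin m → ℝ, ∑ i, c i * (x ⬝ᵥ g i) = 0 := by
    intro x
    have := congrArg (fun z => x ⬝ᵥ z) hcg
    simpa only [dotProduct_sum, dotProduct_smul, smul_eq_mul, dotProduct_zero] using this
  have hpos : 0 < ∑ i, c i := Finset.sum_pos (fun i _ => hc i) Finset.univ_nonempty
  have hyr : ∀ r, c r * (1 - y r ⬝ᵥ g r) = ∑ i, c i := by
    intro r
    have h1 : ∑ i, c i * (1 - y r ⬝ᵥ g i) = ∑ i, c i := by
      simp only [mul_sub, mul_one, Finset.sum_sub_distrib, hbal, sub_zero]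
    rw [← h1, Finset.sum_eq_single r]
    · intro b _ hb; rw [hyg r b hb]; ring
    · simp
  have hdual : dualPolytope (convexHull ℝ (Set.range g)) = convexHull ℝ (Set.range y) := by
    apply Set.Subset.antisymm
    · intro x hx
      rw [mem_dualPolytope_convexHull] at hx
      have hx' : ∀ i, 0 ≤ 1 - x ⬝ᵥ g i := fun i => sub_nonneg.2 (hx _ ⟨i, rfl⟩)
      -- Barycentric coordinates of `x` with respect to the `y i`: the slack of `x` at `g i`, scaled
      -- by its value `(∑ j, c j) / c i` at `y i`.
      let lam : Fin (m + 1) → ℝ := fun i => c i * (1 - x ⬝ᵥ g i) / ∑ j, c j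
      have hlam1 : ∑ i, lam i = 1 := by
        simp only [lam, ← Finset.sum_div, mul_sub, mul_one, Finset.sum_sub_distrib, hbal, sub_zero]
        exact div_self hpos.ne'
      have hxy : x = ∑ i, lam i • y i := by
        have hortho : ∀ j, (x - ∑ i, lam i • y i) ⬝ᵥ g j = 0 := by
          intro j
          have h1 : ∑ i, lam i * (1 - y i ⬝ᵥ g j) = 1 - x ⬝ᵥ g j := by
            rw [Finset.sum_eq_single j]
            · have := hyr j
              simp only [lam]
              rw [div_mul_eq_mul_div, div_eq_iff hpos.ne', ← this]; ring
            · intro b _ hb; rw [hyg b j hb.symm]; ring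
            · simp
          simp only [mul_sub, mul_one, Finset.sum_sub_distrib, hlam1] at h1
          rw [sub_dotProduct, sum_dotProduct]
          simp only [smul_dotProduct, smul_eq_mul]
          linarith
        have hzero : ∀ z, (x - ∑ i, lam i • y i) ⬝ᵥ z = 0 := by
          intro z
          have hz : z ∈ Submodule.span ℝ (Set.range g) := hgspan ▸ Submodule.mem_top
          induction hz using Submodule.span_induction with
          | mem z hz => obtain ⟨j, rfl⟩ := hz; exact hortho j
          | zero => simp
          | add a b _ _ ha hb => rw [dotProduct_add, ha, hb, add_zero]
          | smul a b _ hb => rw [dotProduct_smul, hb, smul_zero]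
        exact sub_eq_zero.1 (dotProduct_self_eq_zero.1 (hzero _))
      rw [hxy]
      exact (convex_convexHull ℝ _).sum_mem
        (fun i _ => div_nonneg (mul_nonneg (hc i).le (hx' i)) hpos.le) hlam1
        fun i _ => subset_convexHull ℝ _ ⟨i, rfl⟩
    · have hconv : Convex ℝ (dualPolytope (convexHull ℝ (Set.range g))) := by
        intro a ha b hb s t hs ht hst z hz
        rw [add_dotProduct, smul_dotProduct, smul_dotProduct, smul_eq_mul, smul_eq_mul]
        nlinarith [ha z hz, hb z hz]
      refine convexHull_min ?_ hconv
      rintro _ ⟨r, rfl⟩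
      rw [mem_dualPolytope_convexHull]
      rintro _ ⟨j, rfl⟩
      by_cases hj : j = r
      · subst hj
        have := hyr j
        have h3 : 0 ≤ 1 - y j ⬝ᵥ g j := by
          by_contra! hneg
          exact absurd this (ne_of_lt ((mul_neg_of_pos_of_neg (hc j) hneg).trans hpos))
        linarith
      · exact (hyg r j hj).le
  refine ⟨m, convexHull ℝ (Set.range g), ⟨⟨_, Set.finite_range g, ?_, rfl⟩, hint,
    _, Set.finite_range y, ?_, hdual⟩, f.toAffineMap, ?_, ?_, himage⟩
  · rintro _ ⟨i, rfl⟩; exact hgint i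
  · rintro _ ⟨r, rfl⟩; exact fun k => ⟨_, rfl⟩
  · intro a ha b hb hab
    have ha' := (hspan a).1 ha
    have hb' := (hspan b).1 hb
    have hab' : ∀ k : Fin m, a k.succ = b k.succ := fun k => congrFun hab k
    rw [Fin.sum_univ_succ] at ha' hb'
    simp only [hab'] at ha'
    ext i
    refine Fin.cases (by linarith) hab' i
  · have htop : affineSpan ℝ (convexHull ℝ (Set.range g)) = ⊤ :=
      affineSpan_eq_top_of_nonempty_interior (by
        rw [(convex_convexHull ℝ (Set.range g)).convexHull_eq]; exact ⟨0, hint⟩)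
    rw [htop]
    apply Set.Subset.antisymm
    · rintro _ ⟨x, ⟨-, hx⟩, rfl⟩
      exact ⟨trivial, fun k => hx k.succ⟩
    · rintro z ⟨-, hz⟩
      obtain ⟨x, hx, rfl, hxi⟩ := hlift z
      exact ⟨x, ⟨(hspan x).2 hx, hxi hz⟩, rfl⟩

/-- A simplex spanned by the rows of an integer matrix with positive left kernel and constant
right kernel is reflexive exactly when all vertices of its dual are lattice points. -/
theorem isReflexive_convexHull_rows_iff {n : ℕ} [NeZero n] {A : Matrix (Fin n) (Fin n) ℤ}
    {c : Fin n → ℝ} (hc : ∀ i, 0 < c i) (hcA : ∀ j, ∑ i, c i * A i j = 0)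
    (hrow : ∀ i, ∑ j, A i j = 0)
    (hker : ∀ v : Fin n → ℝ, (∀ i, ∑ j, A i j * v j = 0) → ∀ i j, v i = v j) :
    IsReflexive (convexHull ℝ (Set.range fun i j => (A i j : ℝ))) ↔
      ∀ r, ∃ v : Fin n → ℤ, ∀ j, j ≠ r → ∑ k, A j k * v k = 1 := by
  obtain ⟨m, rfl⟩ := Nat.exists_eq_succ_of_ne_zero (NeZero.ne n)
  have hcA' : ∑ i, c i • (fun j => (A i j : ℝ)) = 0 := by
    ext j; simpa using hcA j
  have hrow' : ∀ i, ∑ j, (A i j : ℝ) = 0 := fun i => by exact_mod_cast hrow i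
  exact ⟨fun h r => exists_int_of_isReflexive hc hcA' hrow' hker h r,
    isReflexive_of_exists_int hc hcA' hrow' hker⟩

/-! ### Invariance under isomorphism of digraphs -/

section Digraph

variable {V W : Type*}

theorem outdeg_congr {D : Digraph V} {E : Digraph W} (e : V ≃ W)
    (he : ∀ x y, D.Adj x y ↔ E.Adj (e x) (e y)) (x : V) : outdeg D x = outdeg E (e x) :=
  Nat.card_congr (e.subtypeEquiv fun y => he x y)

theorem isConvergingTree_congr {D : Digraph V} {E : Digraph W} (e : V ≃ W)
    (he : ∀ x y, D.Adj x y ↔ E.Adj (e x) (e y)) (r : V) :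
    IsConvergingTree D r ↔ IsConvergingTree E (e r) := by
  have iso : D.toSimpleGraphInclusive ≃g E.toSimpleGraphInclusive :=
    ⟨e, by simp [Digraph.toSimpleGraphInclusive, he]⟩
  unfold IsConvergingTree
  rw [iso.connected_iff, outdeg_congr e he, e.forall_congr_left]
  simp only [outdeg_congr e he, Equiv.apply_symm_apply, ne_eq, Equiv.symm_apply_eq]

theorem treeCount_congr {D : Digraph V} {E : Digraph W} (e : V ≃ W)
    (he : ∀ x y, D.Adj x y ↔ E.Adj (e x) (e y)) (r : V) :
    treeCount D r = treeCount E (e r) := by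
  let F : Digraph V ≃ Digraph W :=
    { toFun := fun T => ⟨fun x y => T.Adj (e.symm x) (e.symm y)⟩
      invFun := fun T => ⟨fun x y => T.Adj (e x) (e y)⟩
      left_inv := fun T => by ext; simp
      right_inv := fun T => by ext; simp }
  refine Nat.card_congr (F.subtypeEquiv fun T => and_congr ?_ ?_)
  · constructor
    · intro h x y hxy
      have := (he _ _).1 (h hxy)
      simpa using this
    · intro h x y hxy
      exact (he _ _).2 (h (show T.Adj (e.symm (e x)) (e.symm (e y)) by simpa using hxy))
  · exact isConvergingTree_congr e (fun x y => by simp [F]) r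

theorem complexity_congr [Fintype V] [Fintype W] {D : Digraph V} {E : Digraph W} (e : V ≃ W)
    (he : ∀ x y, D.Adj x y ↔ E.Adj (e x) (e y)) : complexity D = complexity E := by
  unfold complexity
  rw [← e.sum_comp]
  exact Finset.sum_congr rfl fun r _ => treeCount_congr e he r

theorem laplacian_congr {D : Digraph V} {E : Digraph W} (e : V ≃ W)
    (he : ∀ x y, D.Adj x y ↔ E.Adj (e x) (e y)) :
    laplacian D = (laplacian E).submatrix e e := by
  ext i j
  simp only [laplacian, adjMatrix, Matrix.sub_apply, Matrix.submatrix_apply, Matrix.of_apply,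
    Matrix.diagonal_apply, outdeg_congr e he]
  congr 1
  · by_cases h : i = j <;> simp [h]
  · by_cases h : D.Adj i j
    · rw [if_pos h, if_pos ((he i j).1 h)]
    · rw [if_neg h, if_neg fun h' => h ((he i j).2 h')]

open Classical in
theorem sum_laplacian_mul [Fintype V] {K : Type*} [CommRing K] (D : Digraph V) (v : V → K)
    (i : V) : ∑ j, (laplacian D i j : K) * v j = ∑ j, if D.Adj i j then v i - v j else 0 := by
  have hdeg : (outdeg D i : K) = ∑ j, if D.Adj i j then 1 else 0 := by
    rw [outdeg, Nat.card_eq_fintype_card, Fintype.card_subtype, Finset.sum_boole]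
  simp only [laplacian, adjMatrix, Matrix.sub_apply, Matrix.of_apply, Matrix.diagonal_apply]
  push_cast
  simp only [sub_mul, Finset.sum_sub_distrib, ite_mul, zero_mul, one_mul, Finset.sum_ite_eq,
    Finset.mem_univ, if_true, hdeg, Finset.sum_mul]
  rw [← Finset.sum_sub_distrib]
  refine Finset.sum_congr rfl fun j _ => ?_
  split_ifs <;> simp

/-- The reflexivity criterion, transported along an isomorphism of digraphs. -/
theorem isReflexive_laplacianPolytope_iff {n : ℕ} [NeZero n] {D : Digraph (Fin n)} [Fintype W]
    {E : Digraph W} (e : Fin n ≃ W) (he : ∀ x y, D.Adj x y ↔ E.Adj (e x) (e y))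
    {c : W → ℤ} (hc : ∀ i, 0 < c i) (hcE : ∀ v : W → ℤ, ∑ i, c i * ∑ j, laplacian E i j * v j = 0)
    (hker : ∀ v : W → ℝ, (∀ i, ∑ j, (laplacian E i j : ℝ) * v j = 0) → ∀ i j, v i = v j) :
    IsReflexive (laplacianPolytope D) ↔
      ∀ r, ∃ v : W → ℤ, ∀ j, j ≠ r → ∑ k, laplacian E j k * v k = 1 := by
  classical
  have hlap : ∀ i j, laplacian D i j = laplacian E (e i) (e j) := fun i j => by
    rw [laplacian_congr e he]; rfl
  rw [laplacianPolytope, isReflexive_convexHull_rows_iff (c := fun i => (c (e i) : ℝ))]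
  · rw [e.forall_congr_left]
    refine forall_congr' fun r => ?_
    constructor
    · rintro ⟨v, hv⟩
      refine ⟨v ∘ e.symm, fun j hj => ?_⟩
      rw [← hv (e.symm j) (by simpa using hj), ← e.sum_comp]
      simp [hlap]
    · rintro ⟨v, hv⟩
      refine ⟨v ∘ e, fun j hj => ?_⟩
      rw [← hv (e j) (by rintro rfl; simp at hj), ← e.sum_comp]
      simp [hlap]
  · exact fun i => by exact_mod_cast hc (e i)
  · intro j
    have := hcE (Pi.single (e j) 1)
    rw [← e.sum_comp] at this
    simp only [Pi.single_apply, mul_ite, mul_one, mul_zero, Finset.sum_ite_eq', Finset.mem_univ,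
      if_true] at this
    simp only [hlap]
    exact_mod_cast this
  · intro i
    have := sum_laplacian_mul D (fun _ => (1 : ℤ)) i
    simpa using this
  · intro v hv i j
    have := hker (v ∘ e.symm) (fun i => by
      rw [← hv (e.symm i), ← e.sum_comp]; simp [hlap]) (e i) (e j)
    simpa using this

end Digraph

variable {n : ℕ} [NeZero n]

/-! ### Cyclic arithmetic and difference equations -/

section Steps

theorem val_add_one_eq_mod (i : Fin n) : (i + 1).val = (i.val + 1) % n := by
  simp [Fin.add_def]

theorem ofNat_succ_eq (k : ℕ) : Fin.ofNat n (k + 1) = Fin.ofNat n k + 1 := by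
  ext; simp [val_add_one_eq_mod]

theorem ofNat_val_eq (i : Fin n) : Fin.ofNat n i.val = i := by
  ext; simp

theorem step_induction {P : Fin n → Prop} (i : Fin n) (h0 : P i) (hs : ∀ j, P j → P (j + 1))
    (j : Fin n) : P j := by
  have h : ∀ k : ℕ, P (i + Fin.ofNat n k) := by
    intro k
    induction k with
    | zero => simpa using h0
    | succ k ih => rw [ofNat_succ_eq, ← add_assoc]; exact hs _ ih
  have := h (j - i).val
  rwa [ofNat_val_eq, add_sub_cancel] at this

theorem val_sub_eq_pred_add_one {b j : Fin n} (hj : j ≠ b) :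
    (j - b).val = (j - 1 - b).val + 1 := by
  have hne : j - b ≠ 0 := sub_ne_zero.2 hj
  rw [sub_right_comm, Fin.val_sub_one_of_ne_zero hne]
  have : (j - b).val ≠ 0 := fun h => hne (Fin.ext h)
  omega

theorem val_add_one_sub {b j : Fin n} (hj : j + 1 ≠ b) :
    (j + 1 - b).val = (j - b).val + 1 := by
  rw [val_sub_eq_pred_add_one hj, add_sub_cancel_right]

theorem add_ofNat_val_sub (b j : Fin n) : b + Fin.ofNat n (j - b).val = j := by
  rw [ofNat_val_eq, add_sub_cancel]

theorem val_add_ofNat_sub (b : Fin n) {k : ℕ} (hk : k < n) :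
    (b + Fin.ofNat n k - b).val = k := by
  rw [add_sub_cancel_left]; simp [Nat.mod_eq_of_lt hk]

/-- Partial sums from 0 work; the vanishing total is needed only to close up at the wraparound. -/
theorem exists_primitive {d : Fin n → ℤ} (hd : ∑ i, d i = 0) :
    ∃ v : Fin n → ℤ, ∀ i, v (i + 1) - v i = d i := by
  refine ⟨fun i => ∑ k ∈ Finset.range i.val, d (Fin.ofNat n k), fun i => ?_⟩
  have hsucc : ∑ k ∈ Finset.range (i.val + 1), d (Fin.ofNat n k) =
      ∑ k ∈ Finset.range i.val, d (Fin.ofNat n k) + d i := by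
    rw [Finset.sum_range_succ, ofNat_val_eq]
  simp only [val_add_one_eq_mod]
  rcases Nat.lt_or_ge (i.val + 1) n with h | h
  · rw [Nat.mod_eq_of_lt h, hsucc]; ring
  · have hn : i.val + 1 = n := le_antisymm i.isLt h
    have hfull : ∑ k ∈ Finset.range n, d (Fin.ofNat n k) = 0 := by
      rw [Finset.sum_range, ← hd]
      exact Finset.sum_congr rfl fun i _ => by rw [ofNat_val_eq]
    rw [hn] at hsucc ⊢
    rw [Nat.mod_self, Finset.range_zero, Finset.sum_empty]
    linarith

theorem sum_sub_shift (v : Fin n → ℤ) : ∑ i, (v (i + 1) - v i) = 0 := by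
  rw [Finset.sum_sub_distrib, sub_eq_zero]
  exact Equiv.sum_comp (Equiv.addRight (1 : Fin n)) v

-- The vertex `b` outside `S` cuts the cycle open: its value needs no predecessor, so the recursion
-- can start there and run once around.
open Classical in
theorem exists_recursive {S : Set (Fin n)} {b : Fin n} (hb : b ∉ S) (w : Fin n → ℤ) :
    ∃ d : Fin n → ℤ, ∀ j, d j = (if j ∈ S then d (j - 1) else 0) - w j := by
  let D : ℕ → ℤ := fun k => Nat.rec (-w b)
    (fun k x => (if b + Fin.ofNat n (k + 1) ∈ S then x else 0) - w (b + Fin.ofNat n (k + 1))) k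
  refine ⟨fun j => D (j - b).val, fun j => ?_⟩
  by_cases hj : j = b
  · subst hj; simp [hb, D]
  · have hval : (j - b).val = (j - 1 - b).val + 1 := val_sub_eq_pred_add_one hj
    have hback : b + Fin.ofNat n ((j - 1 - b).val + 1) = j := by
      rw [← hval, ofNat_val_eq, add_sub_cancel]
    beta_reduce
    rw [hval]
    change (if b + Fin.ofNat n ((j - 1 - b).val + 1) ∈ S then D (j - 1 - b).val else 0)
      - w (b + Fin.ofNat n ((j - 1 - b).val + 1)) = _
    rw [hback]

end Steps

/-- The distance from `r` to the next vertex outside of `S` in clockwise direction. -/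
def nextGap (S : Set (Fin n)) (r : Fin n) : ℕ :=
  sInf {k : ℕ | 1 ≤ k ∧ r + Fin.ofNat n k ∉ S}

/-! ### Gaps to the next vertex outside `S` -/

section Gap

variable {S : Set (Fin n)}

theorem exists_gap (hS : S ≠ Set.univ) (r : Fin n) :
    ∃ k, (1 ≤ k ∧ r + Fin.ofNat n k ∉ S) ∧ k ≤ n := by
  obtain ⟨b, hb⟩ := (Set.ne_univ_iff_exists_notMem S).1 hS
  refine ⟨(b - 1 - r).val + 1, ⟨by omega, ?_⟩, (b - 1 - r).isLt⟩
  rw [ofNat_succ_eq, ofNat_val_eq, ← add_assoc, add_sub_cancel, sub_add_cancel]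
  exact hb

theorem nextGap_spec (hS : S ≠ Set.univ) (r : Fin n) :
    1 ≤ nextGap S r ∧ r + Fin.ofNat n (nextGap S r) ∉ S :=
  Nat.sInf_mem (s := {k : ℕ | 1 ≤ k ∧ r + Fin.ofNat n k ∉ S})
    (let ⟨k, hk, _⟩ := exists_gap hS r; ⟨k, hk⟩)

theorem nextGap_le (hS : S ≠ Set.univ) (r : Fin n) : nextGap S r ≤ n :=
  let ⟨_, hk, hkn⟩ := exists_gap hS r
  (Nat.sInf_le hk).trans hkn

theorem mem_of_lt_nextGap {r : Fin n} {k : ℕ} (h1 : 1 ≤ k) (hk : k < nextGap S r) :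
    r + Fin.ofNat n k ∈ S := by
  by_contra h
  exact Nat.notMem_of_lt_sInf hk ⟨h1, h⟩

theorem le_nextGap (hS : S ≠ Set.univ) {r : Fin n} {k : ℕ}
    (h : ∀ i, 1 ≤ i → i < k → r + Fin.ofNat n i ∈ S) : k ≤ nextGap S r := by
  by_contra! hlt
  exact (nextGap_spec hS r).2 (h _ (nextGap_spec hS r).1 hlt)

-- This recursion is the left kernel equation of the Laplacian, read on differences.
open Classical in
theorem nextGap_eq (hS : S ≠ Set.univ) (r : Fin n) :
    nextGap S r = 1 + if r + 1 ∈ S then nextGap S (r + 1) else 0 := by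
  have hshift : ∀ k, r + Fin.ofNat n (k + 1) = r + 1 + Fin.ofNat n k := fun k => by
    rw [ofNat_succ_eq, add_comm (Fin.ofNat n k), add_assoc]
  have hone : r + Fin.ofNat n 1 = r + 1 := by simpa using hshift 0
  split_ifs with h
  · apply le_antisymm
    · refine Nat.sInf_le ⟨by omega, ?_⟩
      rw [add_comm 1, hshift]
      exact (nextGap_spec hS (r + 1)).2
    · refine le_nextGap hS fun i h1 hi => ?_
      obtain ⟨k, rfl⟩ := Nat.exists_eq_add_of_le' h1
      rw [hshift]
      rcases Nat.eq_zero_or_pos k with rfl | hk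
      · simpa using h
      · exact mem_of_lt_nextGap hk (by omega)
  · exact le_antisymm (Nat.sInf_le ⟨le_rfl, by rwa [hone]⟩) (nextGap_spec hS r).1

end Gap

/-! ### The integrality condition for cycle digraphs -/

section Cycle

variable {S : Set (Fin n)}

-- The hypothesis keeps the two edges leaving a vertex of `S` distinct; coinciding edges would count
-- only once.
open Classical in
theorem sum_laplacian_cycleDigraph_mul (h : ∀ i ∈ S, i + 1 ≠ i - 1) {K : Type*} [CommRing K]
    (v : Fin n → K) (i : Fin n) :
    ∑ j, (laplacian (cycleDigraph n S) i j : K) * v j =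
      (v i - v (i + 1)) + if i ∈ S then v i - v (i - 1) else 0 := by
  rw [sum_laplacian_mul]
  have hsplit : ∀ j, (if (cycleDigraph n S).Adj i j then v i - v j else 0) =
      (if j = i + 1 then v i - v j else 0) +
        if j = i - 1 then (if i ∈ S then v i - v j else 0) else 0 := by
    intro j
    simp only [cycleDigraph]
    by_cases h1 : j = i + 1 <;> by_cases h2 : j = i - 1 <;> by_cases h3 : i ∈ S <;>
      simp_all
    exact (h i h3 h1.symm).elim
  simp only [hsplit, Finset.sum_add_distrib, Finset.sum_ite_eq', Finset.mem_univ, if_true]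

/-- Maximum principle: where `v` is maximal the differences to the out-neighbours are nonnegative
with sum zero, so the maximum propagates clockwise. -/
theorem eq_of_laplacian_cycleDigraph_mul_eq_zero (h : ∀ i ∈ S, i + 1 ≠ i - 1) (v : Fin n → ℝ)
    (hv : ∀ i, ∑ j, (laplacian (cycleDigraph n S) i j : ℝ) * v j = 0) (i j : Fin n) :
    v i = v j := by
  classical
  obtain ⟨m, -, hm⟩ := Finset.exists_max_image Finset.univ v Finset.univ_nonempty
  have hconst : ∀ j, v j = v m := by
    refine step_induction m rfl fun j hj => ?_
    have h1 := hv j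
    rw [sum_laplacian_cycleDigraph_mul h] at h1
    have h2 := hm (j + 1) (Finset.mem_univ _)
    have h3 := hm (j - 1) (Finset.mem_univ _)
    split_ifs at h1 <;> linarith
  rw [hconst i, hconst j]

/-- After an index shift, `nextGap_eq` makes every difference `v (i+1) - v i` appear with the same
coefficient `-1`, and the cyclic sum telescopes. -/
theorem sum_nextGap_mul_laplacian (h : ∀ i ∈ S, i + 1 ≠ i - 1) (hS : S ≠ Set.univ)
    (v : Fin n → ℤ) :
    ∑ i, (nextGap S i : ℤ) * ∑ j, laplacian (cycleDigraph n S) i j * v j = 0 := by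
  classical
  have hL := sum_laplacian_cycleDigraph_mul h v
  simp only [Int.cast_id] at hL
  simp only [hL, mul_add, Finset.sum_add_distrib]
  rw [← Equiv.sum_comp (Equiv.addRight (1 : Fin n))
    (fun i => (nextGap S i : ℤ) * if i ∈ S then v i - v (i - 1) else 0),
    ← Finset.sum_add_distrib, ← neg_eq_zero, ← Finset.sum_neg_distrib]
  refine Eq.trans ?_ (sum_sub_shift v)
  refine Finset.sum_congr rfl fun i _ => ?_
  simp only [Equiv.coe_addRight, add_sub_cancel_right]
  rw [nextGap_eq hS i]
  split_ifs <;> push_cast <;> ring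

/-- The dual vertices of the Laplacian polytope of `C_n^S` are integral exactly when each of the
barycentric weights divides their sum. -/
theorem exists_int_cycleDigraph_iff (h : ∀ i ∈ S, i + 1 ≠ i - 1) (hS : S ≠ Set.univ)
    (r : Fin n) :
    (∃ v : Fin n → ℤ, ∀ j, j ≠ r → ∑ k, laplacian (cycleDigraph n S) j k * v k = 1) ↔
      nextGap S r ∣ ∑ i, nextGap S i := by
  classical
  rw [← Int.natCast_dvd_natCast]
  push_cast
  constructor
  · rintro ⟨v, hv⟩
    have h0 := sum_nextGap_mul_laplacian h hS v
    -- Pairing `1 - Lv` with the weights leaves only the term at `r`.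
    have h1 : ∑ i, (nextGap S i : ℤ) *
        (1 - ∑ j, laplacian (cycleDigraph n S) i j * v j) = ∑ i, (nextGap S i : ℤ) := by
      simp only [mul_sub, mul_one, Finset.sum_sub_distrib, h0, sub_zero]
    rw [← h1, Finset.sum_eq_single r (fun b _ hb => by rw [hv b hb]; ring) (by simp)]
    exact dvd_mul_right _ _
  · rintro ⟨q, hq⟩
    obtain ⟨b, hb⟩ := (Set.ne_univ_iff_exists_notMem S).1 hS
    -- The prescribed values of `Lv` are 1 off `r` and `1 - q` at `r`; by the choice of `q` their
    -- weighted sum vanishes, which gives `d` sum zero.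
    obtain ⟨d, hd⟩ := exists_recursive hb fun j => 1 - if j = r then q else 0
    have hsum : ∑ i, d i = 0 := by
      have h1 : ∑ i, (nextGap S i : ℤ) * ((if i ∈ S then d (i - 1) else 0) - d i) = 0 := by
        have h2 : ∀ i, (if i ∈ S then d (i - 1) else 0) - d i = 1 - if i = r then q else 0 :=
          fun i => by rw [hd i]; ring
        simp only [h2, mul_sub, Finset.sum_sub_distrib, mul_one, hq, mul_ite, mul_zero,
          Finset.sum_ite_eq', Finset.mem_univ, if_true, sub_self]
      simp only [mul_sub, Finset.sum_sub_distrib] at h1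
      rw [← Equiv.sum_comp (Equiv.addRight (1 : Fin n))
        (fun i => (nextGap S i : ℤ) * if i ∈ S then d (i - 1) else 0),
        ← Finset.sum_sub_distrib] at h1
      rw [← neg_eq_zero, ← h1, ← Finset.sum_neg_distrib]
      refine Finset.sum_congr rfl fun i _ => ?_
      simp only [Equiv.coe_addRight, add_sub_cancel_right]
      rw [nextGap_eq hS i]
      split_ifs <;> push_cast <;> ring
    obtain ⟨v, hv⟩ := exists_primitive hsum
    refine ⟨v, fun j hj => ?_⟩
    have hL := sum_laplacian_cycleDigraph_mul h v j
    simp only [Int.cast_id] at hL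
    have h1 := hv j
    have h2 := hv (j - 1)
    rw [sub_add_cancel] at h2
    have h3 := hd j
    rw [if_neg hj] at h3
    rw [hL]
    split_ifs at h3 ⊢ <;> linarith

/-- Away from `r` the difference drops by 1 at each step, so with value `x` at `r` the cyclic sum is
`n x - n (n - 1) / 2`, which is zero iff `n = 2 x + 1`. -/
theorem exists_int_cycleDigraph_univ_iff (h : ∀ i : Fin n, i + 1 ≠ i - 1) :
    (∀ r, ∃ v : Fin n → ℤ, ∀ j, j ≠ r →
      ∑ k, laplacian (cycleDigraph n Set.univ) j k * v k = 1) ↔ Odd n := by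
  classical
  have hL : ∀ (v : Fin n → ℤ) j, ∑ k, laplacian (cycleDigraph n Set.univ) j k * v k =
      (v j - v (j - 1)) - (v (j + 1) - v j) := fun v j => by
    have := sum_laplacian_cycleDigraph_mul (S := Set.univ) (fun i _ => h i) v j
    simp only [Int.cast_id, Set.mem_univ, if_true] at this
    rw [this]; ring
  have hgauss : ∀ x : ℤ, 2 * ∑ j : Fin n, (x - (j.val : ℤ)) = n * (2 * x - (n - 1)) := by
    intro x
    have h1 : (∑ i ∈ Finset.range n, (i : ℤ)) * 2 = n * (n - 1) := by
      have := Finset.sum_range_id_mul_two n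
      zify [Nat.one_le_iff_ne_zero.2 (NeZero.ne n)] at this
      exact this
    rw [Finset.sum_range] at h1
    rw [Finset.sum_sub_distrib, Finset.sum_const, Finset.card_univ, Fintype.card_fin, nsmul_eq_mul]
    linarith
  constructor
  · intro H
    obtain ⟨v, hv⟩ := H 0
    have hd : ∀ k : ℕ, k < n → ∀ j : Fin n, j.val = k →
        v (j + 1) - v j = (v (0 + 1) - v 0) - j.val := by
      intro k
      induction k with
      | zero =>
        intro _ j hj
        obtain rfl : j = 0 := Fin.ext hj
        simp
      | succ k ih =>
        intro hk j hj
        have hj0 : j ≠ 0 := fun h => by simp [h] at hj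
        have h1 := hv j hj0
        rw [hL] at h1
        have hval : (j - 1).val = k := by rw [Fin.val_sub_one_of_ne_zero hj0]; omega
        have h2 := ih (by omega) (j - 1) hval
        rw [sub_add_cancel, hval] at h2
        rw [hj]; push_cast; linarith
    have hsum := sum_sub_shift v
    rw [Finset.sum_congr rfl fun j _ => hd j.val j.isLt j rfl] at hsum
    have h2 := hgauss (v (0 + 1) - v 0)
    rw [hsum, mul_zero, eq_comm, mul_eq_zero] at h2
    rcases h2 with h2 | h2
    · exact absurd (by exact_mod_cast h2) (NeZero.ne n)
    · have : Odd (n : ℤ) := ⟨v (0 + 1) - v 0, by linarith⟩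
      exact_mod_cast this
  · rintro ⟨x, hx⟩ r
    have hsum : ∑ j : Fin n, ((x : ℤ) - ((j - r).val : ℤ)) = 0 := by
      refine (Equiv.sum_comp (Equiv.subRight r) (fun j : Fin n => (x : ℤ) - (j.val : ℤ))).trans ?_
      have h1 := hgauss x
      have h2 : 2 * (x : ℤ) - (n - 1) = 0 := by rw [hx]; push_cast; ring
      rw [h2, mul_zero] at h1
      linarith
    obtain ⟨v, hv⟩ := exists_primitive hsum
    refine ⟨v, fun j hj => ?_⟩
    have h1 := hv j
    have h2 := hv (j - 1)
    rw [sub_add_cancel] at h2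
    rw [hL, h1, h2, val_sub_eq_pred_add_one hj]; push_cast; ring

end Cycle

/-! ### Converging trees of cycle digraphs -/

section Outdeg

variable {V : Type*}

theorem not_adj_of_outdeg_eq_zero [Finite V] {T : Digraph V} {v : V} (h : outdeg T v = 0) (w : V) :
    ¬ T.Adj v w := fun hw => by
  rcases Nat.card_eq_zero.1 h with h | h
  · exact h.false ⟨w, hw⟩
  · exact h.not_finite inferInstance

theorem eq_of_outdeg_eq_one {T : Digraph V} {v w w' : V} (h : outdeg T v = 1)
    (hw : T.Adj v w) (hw' : T.Adj v w') : w = w' := by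
  have := (Nat.card_eq_one_iff_unique.1 h).1
  exact congrArg Subtype.val (Subsingleton.elim (⟨w, hw⟩ : {j // T.Adj v j}) ⟨w', hw'⟩)

theorem exists_adj_of_outdeg_eq_one {T : Digraph V} {v : V} (h : outdeg T v = 1) :
    ∃ w, T.Adj v w := by
  obtain ⟨w, hw⟩ := (Nat.card_eq_one_iff_unique.1 h).2
  exact ⟨w, hw⟩

theorem outdeg_eq_one {T : Digraph V} {v w : V} (h : ∀ x, T.Adj v x ↔ x = w) :
    outdeg T v = 1 := by
  refine Nat.card_eq_one_iff_unique.2 ⟨⟨?_⟩, ⟨w, (h w).2 rfl⟩⟩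
  rintro ⟨a, ha⟩ ⟨b, hb⟩
  exact Subtype.ext (((h a).1 ha).trans ((h b).1 hb).symm)

/-- In a converging tree every vertex has a directed path to the root. -/
theorem IsConvergingTree.reflTransGen [Finite V] {T : Digraph V} {r : V}
    (h : IsConvergingTree T r) (x : V) : Relation.ReflTransGen T.Adj x r := by
  obtain ⟨hconn, hr, hout⟩ := h
  have hreach := (SimpleGraph.reachable_iff_reflTransGen r x).1 (hconn.preconnected r x)
  induction hreach with
  | refl => exact .refl
  | @tail y z _ hyz ih =>
    -- If the edge leads from `y` to `z`, it is the only edge out of `y`, so the directed path from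
    -- `y` to the root already passes through `z`.
    rcases hyz.2 with hyz | hzy
    · rcases ih.cases_head with rfl | ⟨w, hyw, hwr⟩
      · exact absurd hyz (not_adj_of_outdeg_eq_zero hr z)
      · have hyr : y ≠ r := by rintro rfl; exact not_adj_of_outdeg_eq_zero hr z hyz
        rwa [eq_of_outdeg_eq_one (hout y hyr) hyz hyw]
    · exact ih.head hzy

theorem connected_of_reflTransGen {T : Digraph V} {r : V}
    (h : ∀ x, Relation.ReflTransGen T.Adj x r) : T.toSimpleGraphInclusive.Connected := by
  rw [SimpleGraph.connected_iff_exists_forall_reachable]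
  refine ⟨r, fun x => SimpleGraph.Reachable.symm ?_⟩
  induction h x using Relation.ReflTransGen.head_induction_on with
  | refl => exact .refl _
  | @head a b hab _ ih =>
    by_cases hne : a = b
    · rwa [hne]
    · exact (SimpleGraph.Adj.reachable (G := T.toSimpleGraphInclusive) ⟨hne, .inl hab⟩).trans ih

end Outdeg

/-- The tree with root `r` in which the first `k` vertices after `r` point counterclockwise and
the other ones point clockwise. -/
def cycleTree (r : Fin n) (k : ℕ) : Digraph (Fin n) where
  Adj x y := (x ≠ r ∧ (x - r).val ≤ k ∧ y = x - 1) ∨ (k < (x - r).val ∧ y = x + 1)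

theorem ne_of_lt_val_sub {r x : Fin n} {k : ℕ} (h : k < (x - r).val) : x ≠ r := by
  rintro rfl
  simp at h

theorem cycleTree_adj_of_le {r x : Fin n} {k : ℕ} (hx : x ≠ r) (hk : (x - r).val ≤ k)
    (y : Fin n) : (cycleTree r k).Adj x y ↔ y = x - 1 := by
  simp [cycleTree, hx, hk]

theorem cycleTree_adj_of_lt {r x : Fin n} {k : ℕ} (hk : k < (x - r).val) (y : Fin n) :
    (cycleTree r k).Adj x y ↔ y = x + 1 := by
  simp [cycleTree, hk]

theorem isConvergingTree_cycleTree (r : Fin n) (k : ℕ) :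
    IsConvergingTree (cycleTree r k) r := by
  refine ⟨connected_of_reflTransGen (r := r) fun x => ?_, ?_, fun x hx => ?_⟩
  · rcases le_or_gt (x - r).val k with hk | hk
    · induction hm : (x - r).val generalizing x with
      | zero => rw [sub_eq_zero.1 (Fin.ext hm : x - r = 0)]
      | succ m ih =>
        have hx : x ≠ r := ne_of_lt_val_sub (k := m) (by omega)
        have := val_sub_eq_pred_add_one hx
        exact (ih (x - 1) (by omega) (by omega)).head ((cycleTree_adj_of_le hx hk _).2 rfl)
    · induction hm : n - (x - r).val generalizing x with
      | zero => have := (x - r).isLt; omega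
      | succ m ih =>
        refine Relation.ReflTransGen.head ((cycleTree_adj_of_lt hk _).2 rfl) ?_
        by_cases hx : x + 1 = r
        · rw [hx]
        · have := val_add_one_sub hx
          exact ih (x + 1) (by omega) (by omega)
  · have : IsEmpty {y // (cycleTree r k).Adj r y} := ⟨fun ⟨y, hy⟩ => by simp [cycleTree] at hy⟩
    exact Nat.card_of_isEmpty
  · rcases le_or_gt (x - r).val k with hk | hk
    · exact outdeg_eq_one (cycleTree_adj_of_le hx hk)
    · exact outdeg_eq_one (cycleTree_adj_of_lt hk)

variable {S : Set (Fin n)}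

theorem cycleTree_le {r : Fin n} {k : ℕ} (hk : k < nextGap S r) :
    cycleTree r k ≤ cycleDigraph n S := by
  rintro x y (⟨hx, hxk, rfl⟩ | ⟨-, rfl⟩)
  · refine .inr ⟨?_, rfl⟩
    rw [← add_ofNat_val_sub r x]
    exact mem_of_lt_nextGap (by have := val_sub_eq_pred_add_one hx; omega) (by omega)
  · exact .inl rfl

/-- A non-root vertex following one that points clockwise must also point clockwise, since otherwise
the two form a 2-cycle that never reaches the root. So the counterclockwise vertices are an initial
block after `r`. -/
theorem exists_eq_cycleTree (hS : S ≠ Set.univ) {T : Digraph (Fin n)} {r : Fin n}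
    (hT : T ≤ cycleDigraph n S) (hr : IsConvergingTree T r) :
    ∃ k < nextGap S r, cycleTree r k = T := by
  classical
  have hout := hr.2.2
  have hdir : ∀ x, x ≠ r → T.Adj x (x + 1) ∨ (x ∈ S ∧ T.Adj x (x - 1)) := by
    intro x hx
    obtain ⟨y, hy⟩ := exists_adj_of_outdeg_eq_one (hout x hx)
    rcases hT hy with rfl | ⟨hxS, rfl⟩
    · exact .inl hy
    · exact .inr ⟨hxS, hy⟩
  have hstep : ∀ x, x ≠ r → x + 1 ≠ r → T.Adj x (x + 1) → T.Adj (x + 1) (x + 1 + 1) := by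
    intro x hx hx1 hadj
    rcases hdir (x + 1) hx1 with h | ⟨-, hback⟩
    · exact h
    exfalso
    rw [add_sub_cancel_right] at hback
    have hstay : ∀ z, Relation.ReflTransGen T.Adj x z → z = x ∨ z = x + 1 := by
      intro z hz
      induction hz with
      | refl => exact .inl rfl
      | tail _ hyz ih =>
        rcases ih with rfl | rfl
        · exact .inr (eq_of_outdeg_eq_one (hout _ hx) hyz hadj)
        · exact .inl (eq_of_outdeg_eq_one (hout _ hx1) hyz hback)
    rcases hstay r (hr.reflTransGen x) with h | h
    · exact hx h.symm
    · exact hx1 h.symm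
  -- The first distance at which the vertex points clockwise. Distance `n` holds vacuously and
  -- covers the tree with no clockwise edge.
  have hex : ∃ j, 1 ≤ j ∧ ∀ x, (x - r).val = j → T.Adj x (x + 1) :=
    ⟨n, Nat.one_le_iff_ne_zero.2 (NeZero.ne n), fun x hx => absurd hx (x - r).isLt.ne⟩
  have hjn : Nat.find hex ≤ n := Nat.find_min' hex
    ⟨Nat.one_le_iff_ne_zero.2 (NeZero.ne n), fun x hx => absurd hx (x - r).isLt.ne⟩
  obtain ⟨hj1, hj⟩ := Nat.find_spec hex
  have hmin : ∀ j < Nat.find hex, ¬ (1 ≤ j ∧ ∀ x, (x - r).val = j → T.Adj x (x + 1)) :=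
    fun j => Nat.find_min hex
  obtain ⟨k, hk⟩ := Nat.exists_eq_add_of_le' hj1
  rw [hk] at hjn hj hmin
  have hforward : ∀ x, k < (x - r).val → T.Adj x (x + 1) := by
    intro x hx
    induction hm : (x - r).val generalizing x with
    | zero => omega
    | succ m ih =>
      rcases Nat.eq_or_lt_of_le (show k + 1 ≤ (x - r).val from hx) with h | h
      · exact hj x h.symm
      · have hxr := ne_of_lt_val_sub hx
        have hval := val_sub_eq_pred_add_one hxr
        have hx1 : k < (x - 1 - r).val := by omega
        have := hstep (x - 1) (ne_of_lt_val_sub hx1) (by rwa [sub_add_cancel])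
          (ih (x - 1) hx1 (by omega))
        rwa [sub_add_cancel] at this
  have hback : ∀ x, x ≠ r → (x - r).val ≤ k → x ∈ S ∧ T.Adj x (x - 1) := by
    intro x hx hxk
    have h1 := val_sub_eq_pred_add_one hx
    have hnot : ¬ T.Adj x (x + 1) := fun hadj => hmin (x - r).val (by omega) ⟨by omega, fun y hy => by
      rw [sub_left_injective (Fin.ext hy : y - r = x - r)]; exact hadj⟩
    exact (hdir x hx).resolve_left hnot
  refine ⟨k, le_nextGap hS fun i hi1 hik => ?_, ?_⟩
  · have hval := val_add_ofNat_sub r (show i < n by omega)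
    exact (hback _ (ne_of_lt_val_sub (k := 0) (by omega)) (by omega)).1
  · ext x y
    by_cases hx : x = r
    · subst hx
      refine iff_of_false (by simp [cycleTree]) (not_adj_of_outdeg_eq_zero hr.2.1 y)
    · rcases le_or_gt (x - r).val k with hxk | hxk
      · rw [cycleTree_adj_of_le hx hxk]
        refine ⟨?_, fun hy => eq_of_outdeg_eq_one (hout x hx) hy (hback x hx hxk).2⟩
        rintro rfl; exact (hback x hx hxk).2
      · rw [cycleTree_adj_of_lt hxk]
        refine ⟨?_, fun hy => eq_of_outdeg_eq_one (hout x hx) hy (hforward x hxk)⟩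
        rintro rfl; exact hforward x hxk

/-- The two trees disagree at distance `l` from `r`, a vertex of `S`, where the two directions have
different heads. -/
theorem cycleTree_ne (h : ∀ i ∈ S, i + 1 ≠ i - 1) (hS : S ≠ Set.univ) {r : Fin n} {k l : ℕ}
    (hl : l < nextGap S r) (hkl : k < l) : cycleTree r k ≠ cycleTree r l := by
  intro heq
  have hval := val_add_ofNat_sub r (hl.trans_le (nextGap_le hS r))
  have hmem := mem_of_lt_nextGap (show 1 ≤ l by omega) hl
  set x := r + Fin.ofNat n l
  have h1 : (cycleTree r l).Adj x (x - 1) :=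
    (cycleTree_adj_of_le (ne_of_lt_val_sub (k := k) (by omega)) hval.le _).2 rfl
  rw [← heq, cycleTree_adj_of_lt (by omega)] at h1
  exact h x hmem h1.symm

/-- The number of spanning converging trees of `C_n^S` with root `r`. -/
theorem treeCount_cycleDigraph (h : ∀ i ∈ S, i + 1 ≠ i - 1) (hS : S ≠ Set.univ) (r : Fin n) :
    treeCount (cycleDigraph n S) r = nextGap S r := by
  let F : Fin (nextGap S r) → {T : Digraph (Fin n) // T ≤ cycleDigraph n S ∧ IsConvergingTree T r} :=
    fun k => ⟨cycleTree r k, cycleTree_le k.isLt, isConvergingTree_cycleTree r k⟩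
  have hF : Function.Bijective F := by
    constructor
    · intro k l hkl
      have heq : cycleTree r k.val = cycleTree r l.val := congrArg Subtype.val hkl
      rcases lt_trichotomy k.val l.val with hlt | he | hlt
      · exact absurd heq (cycleTree_ne h hS l.isLt hlt)
      · exact Fin.ext he
      · exact absurd heq.symm (cycleTree_ne h hS k.isLt hlt)
    · rintro ⟨T, hT, hr⟩
      obtain ⟨k, hk, rfl⟩ := exists_eq_cycleTree hS hT hr
      exact ⟨⟨k, hk⟩, rfl⟩
  rw [treeCount, ← Nat.card_eq_of_bijective F hF, Nat.card_fin]

theorem complexity_cycleDigraph (h : ∀ i ∈ S, i + 1 ≠ i - 1) (hS : S ≠ Set.univ) :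
    complexity (cycleDigraph n S) = ∑ r, nextGap S r :=
  Finset.sum_congr rfl fun r _ => treeCount_cycleDigraph h hS r

/-! ### Longest run and the reflexivity criteria -/

theorem nextGap_le_longestRun_add_one (hS : S ≠ Set.univ) (r : Fin n) :
    nextGap S r ≤ longestRun n S + 1 := by
  have hle : nextGap S r - 1 ≤ longestRun n S := by
    refine le_csSup ⟨n, fun j hj => hj.1⟩ ⟨?_, r, fun i h1 hi => mem_of_lt_nextGap h1 ?_⟩
    · have := nextGap_le hS r; omega
    · omega
  omega

theorem exists_nextGap_eq_longestRun_add_one (hS : S ≠ Set.univ) :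
    ∃ r, nextGap S r = longestRun n S + 1 := by
  obtain ⟨-, a, ha⟩ := Nat.sSup_mem
    (s := {j : ℕ | j ≤ n ∧ ∃ a : Fin n, ∀ i : ℕ, 1 ≤ i → i ≤ j → a + Fin.ofNat n i ∈ S})
    ⟨0, Nat.zero_le n, 0, fun i h1 h0 => by omega⟩ ⟨n, fun j hj => hj.1⟩
  exact ⟨a, le_antisymm (nextGap_le_longestRun_add_one hS a)
    (le_nextGap hS fun i h1 hi => ha i h1 (Nat.lt_succ_iff.1 hi))⟩

/-- Moving one vertex clockwise inside a run lowers the gap by exactly 1, so every value below the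
maximum occurs. -/
theorem exists_nextGap_eq (hS : S ≠ Set.univ) {k : ℕ} (h1 : 1 ≤ k)
    (hk : k ≤ longestRun n S + 1) : ∃ r, nextGap S r = k := by
  classical
  induction hk using Nat.decreasingInduction with
  | self => exact exists_nextGap_eq_longestRun_add_one hS
  | of_succ k _ ih =>
    obtain ⟨r, hr⟩ := ih (by omega)
    refine ⟨r + 1, ?_⟩
    rw [nextGap_eq hS r] at hr
    split_ifs at hr <;> omega

theorem forall_nextGap_dvd_iff (hS : S ≠ Set.univ) (c : ℕ) :
    (∀ r, nextGap S r ∣ c) ↔ ∀ k : ℕ, 1 ≤ k → k ≤ longestRun n S + 1 → k ∣ c := by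
  constructor
  · intro h k h1 hk
    obtain ⟨r, rfl⟩ := exists_nextGap_eq hS h1 hk
    exact h r
  · exact fun h r => h _ (nextGap_spec hS r).1 (nextGap_le_longestRun_add_one hS r)

theorem nextGap_empty (r : Fin n) : nextGap (∅ : Set (Fin n)) r = 1 := by
  rw [nextGap_eq Set.empty_ne_univ]; simp

theorem isReflexive_iff_nextGap_dvd {D : Digraph (Fin n)} (h : ∀ i ∈ S, i + 1 ≠ i - 1)
    (hS : S ≠ Set.univ) (e : Fin n ≃ Fin n)
    (he : ∀ x y, D.Adj x y ↔ (cycleDigraph n S).Adj (e x) (e y)) :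
    IsReflexive (laplacianPolytope D) ↔ ∀ r, nextGap S r ∣ complexity D := by
  rw [isReflexive_laplacianPolytope_iff e he (c := fun i => (nextGap S i : ℤ))
    (fun i => by exact_mod_cast (nextGap_spec hS i).1) (sum_nextGap_mul_laplacian h hS)
    (eq_of_laplacian_cycleDigraph_mul_eq_zero h), complexity_congr e he,
    complexity_cycleDigraph h hS]
  exact forall_congr' (exists_int_cycleDigraph_iff h hS)

theorem isReflexive_iff_odd {D : Digraph (Fin n)} (h : ∀ i : Fin n, i + 1 ≠ i - 1)
    (e : Fin n ≃ Fin n)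
    (he : ∀ x y, D.Adj x y ↔ (cycleDigraph n Set.univ).Adj (e x) (e y)) :
    IsReflexive (laplacianPolytope D) ↔ Odd n := by
  have h' : ∀ i ∈ (Set.univ : Set (Fin n)), i + 1 ≠ i - 1 := fun i _ => h i
  rw [isReflexive_laplacianPolytope_iff e he (c := fun _ => 1) (fun _ => one_pos) ?_
    (eq_of_laplacian_cycleDigraph_mul_eq_zero h')]
  · exact exists_int_cycleDigraph_univ_iff h
  · classical
    intro v
    have hL := sum_laplacian_cycleDigraph_mul h' v
    simp only [Int.cast_id, Set.mem_univ, if_true] at hL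
    simp only [one_mul, hL, Finset.sum_add_distrib]
    rw [← Equiv.sum_comp (Equiv.addRight (1 : Fin n)) (fun i => v i - v (i - 1)),
      ← Finset.sum_add_distrib]
    exact Finset.sum_eq_zero fun i _ => by simp

theorem add_one_ne_sub_one (hn : 3 ≤ n) (i : Fin n) : i + 1 ≠ i - 1 := by
  intro h
  rw [eq_sub_iff_add_eq, add_assoc, add_eq_left] at h
  have := congrArg Fin.val h
  rw [val_add_one_eq_mod, Fin.val_one', Nat.mod_eq_of_lt (by omega : 1 < n),
    Nat.mod_eq_of_lt (by omega)] at this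
  simp at this

theorem cycleDigraph_eq_of_two (hn : n = 2) (S T : Set (Fin n)) :
    cycleDigraph n S = cycleDigraph n T := by
  have h2 : ∀ i : Fin n, i - 1 = i + 1 := fun i => by
    rw [eq_comm, eq_sub_iff_add_eq, add_assoc, add_eq_left]
    ext
    rw [val_add_one_eq_mod, Fin.val_one']
    subst hn
    simp
  ext i j
  simp only [cycleDigraph, h2]
  tauto

end LaplacianPolytope
end

theorem theorem4p5 (n : ℕ) [NeZero n] (hn : 2 ≤ n) (S : Set (Fin n))
    (D : Digraph (Fin n))
    (e : D.Adj ≃r (LaplacianPolytope.cycleDigraph n S).Adj) :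
    LaplacianPolytope.IsReflexive (LaplacianPolytope.laplacianPolytope D) ↔
      (S = ∅ ∨
        (S = Set.univ ∧ n = 2) ∨
        (S = Set.univ ∧ Odd n) ∨
        ((S.Nonempty ∧ S ≠ Set.univ) ∧
          ∀ k : ℕ, 1 ≤ k → k ≤ LaplacianPolytope.longestRun n S + 1 →
            k ∣ LaplacianPolytope.complexity D)) := by
  open LaplacianPolytope in
  obtain ⟨e', he⟩ : ∃ e' : Fin n ≃ Fin n,
      ∀ x y, D.Adj x y ↔ (cycleDigraph n S).Adj (e' x) (e' y) :=
    ⟨e.toEquiv, fun x y => e.map_rel_iff.symm⟩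
  have hempty : ∀ i ∈ (∅ : Set (Fin n)), i + 1 ≠ i - 1 := fun i hi => absurd hi (Set.notMem_empty i)
  rcases Nat.eq_or_lt_of_le hn with h2 | h3
  -- For `n = 2` both directions coincide, so the edgewise simpler `S = ∅` may be used, for which
  -- all gaps are 1.
  · rw [cycleDigraph_eq_of_two h2.symm S ∅] at he
    have hrefl : IsReflexive (laplacianPolytope D) :=
      (isReflexive_iff_nextGap_dvd hempty Set.empty_ne_univ e' he).2 fun r => by
        rw [nextGap_empty]; exact one_dvd _
    refine iff_of_true hrefl ?_
    rcases S.eq_empty_or_nonempty with hS | hS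
    · exact .inl hS
    by_cases hU : S = Set.univ
    · exact .inr (.inl ⟨hU, h2.symm⟩)
    refine .inr (.inr (.inr ⟨⟨hS, hU⟩, fun k h1 hk => ?_⟩))
    have hc : complexity D = 2 := by
      rw [complexity_congr e' he, complexity_cycleDigraph hempty Set.empty_ne_univ]
      simp [nextGap_empty, ← h2]
    -- Being a gap of the original `S`, `k` is at most `n = 2`, and both 1 and 2 divide the
    -- complexity 2.
    obtain ⟨r, hr⟩ := exists_nextGap_eq hU h1 hk
    have hk2 : k ≤ 2 := by rw [← hr, h2]; exact nextGap_le hU r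
    rw [hc]
    interval_cases k <;> norm_num
  · have hne := add_one_ne_sub_one (show 3 ≤ n from h3)
    by_cases hU : S = Set.univ
    · subst hU
      rw [isReflexive_iff_odd hne e' he]
      have hU0 : (Set.univ : Set (Fin n)) ≠ ∅ := Set.univ_nonempty.ne_empty
      simp [hU0, h3.ne']
    · rw [isReflexive_iff_nextGap_dvd (fun i _ => hne i) hU e' he]
      rcases S.eq_empty_or_nonempty with rfl | hS
      · simp [nextGap_empty]
      · rw [forall_nextGap_dvd_iff hU]
        simp [hS, hS.ne_empty, hU]
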